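/- A job $j$ has a release time $r_j$, a deadline $d_j$ and a size (processing time) $p_j>0$ with $r_j+p_j\le d_j$; its lifespan is $I(j)=[r_j,d_j]$ and its laxity is $\ell_j=d_j-r_j-p_j\ge 0$. For $\alpha\in(0,1)$, the job is $\alpha$-tight if $p_j\ge\alpha(d_j-r_j)$. For a finite family of jobs (an instance), let $m^*$ be the minimum number of identical machines on which all its jobs can be feasibly scheduled, where preemption and migration are allowed: every job $j$ is processed for $p_j$ units of time in total, only during $I(j)$, and at no time on two machines at once, and each machine processes at most one job at a time. Let $\mu\ge 1$ be an integer, $\beta\in(0,1)$, $G$ a set of $\alpha$-tight jobs of the instance, and $T\subseteq\mathbb{R}$ a non-empty finite union of intervals, with total length $|T|$. The pair $(G,T)$ is weakly $(\mu,\beta)$-critical if (1) each $t\in T$ lies in the lifespans of at least $\mu$ distinct jobs of $G$, and (2) $|T|\ge\frac{\beta}{\mu}\sum_{j\in G}\ell_j$. Theorem. If there exists a weakly $(\mu,\beta)$-critical pair of $\alpha$-tight jobs, then $$m^*=\Omega\!\left(\frac{\mu}{\log_{1/(1-\alpha)}(1/\beta)}\right),$$ where the $\Omega$ is uniform in all parameters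 as long as $\beta$ stays away from $1$ and the logarithm stays away from $0$. Precisely: for every $\varepsilon>0$ there is a constant $c>0$, depending only on $\varepsilon$, such that for every finite instance, all $\alpha\in(0,1)$, $\beta\in(0,1-\varepsilon]$ and $\mu\ge 1$ with $\log_{1/(1-\alpha)}(1/\beta)\ge\varepsilon$, if the instance has a weakly $(\mu,\beta)$-critical pair $(G,T)$ of $\alpha$-tight jobs, then $$m^*\;\ge\; c\cdot\frac{\mu}{\log_{1/(1-\alpha)}(1/\beta)}.$$ -/

import Mathlib

open MeasureTheory

noncomputable section

/-- A job: released at `release`, to be finished by `deadline`, with processing time `size`. -/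
structure Job where
  release : ℝ
  deadline : ℝ
  size : ℝ
  size_pos : 0 < size
  release_add_size_le : release + size ≤ deadline

namespace Job

/-- The lifespan `I(j)` of a job. -/
def lifespan (j : Job) : Set ℝ := Set.Icc j.release j.deadline

/-- The laxity `ℓ_j = d_j - r_j - p_j`. -/
def laxity (j : Job) : ℝ := j.deadline - j.release - j.size

/-- A job is `α`-tight if its size is at least an `α` fraction of the length of its lifespan. -/
def IsTight (α : ℝ) (j : Job) : Prop := α * (j.deadline - j.release) ≤ j.size

end Job

/-- A preemptive schedule of the jobs `J` on `m` machines, with migration: `run i t` is the job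
that machine `i` processes at time `t` (`none` if the machine idles). -/
structure Schedule {ι : Type} (J : ι → Job) (m : ℕ) where
  run : Fin m → ℝ → Option ι
  measurableSet_run : ∀ i j, MeasurableSet {t | run i t = some j}
  /-- A job is processed only during its lifespan. -/
  mem_lifespan : ∀ i t j, run i t = some j → t ∈ (J j).lifespan
  /-- No job is processed on two machines at the same time. -/
  not_parallel : ∀ i i' t j, run i t = some j → run i' t = some j → i = i'
  /-- Every job receives its full processing time. -/
  completes : ∀ j, ∑ i, volume.real {t | run i t = some j} = (J j).size

/-- The jobs `J` can be feasibly scheduled on `m` machines. -/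
def FeasibleOn {ι : Type} (J : ι → Job) (m : ℕ) : Prop := Nonempty (Schedule J m)

/-- One machine for each job suffices, so that the minimum below is over a nonempty set. -/
theorem feasibleOn_card {ι : Type} [Fintype ι] (J : ι → Job) :
    FeasibleOn J (Fintype.card ι) := by
  classical
  let e := (Fintype.equivFin ι).symm
  have key : ∀ i j, {t : ℝ | (if t ∈ Set.Icc (J (e i)).release ((J (e i)).release + (J (e i)).size)
      then some (e i) else none) = some j} =
      if e i = j then Set.Icc (J j).release ((J j).release + (J j).size) else ∅ := by
    intro i j
    ext t
    by_cases h : e i = j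
    · subst h; simp
    · simp [h]
  refine ⟨⟨fun i t => if t ∈ Set.Icc (J (e i)).release ((J (e i)).release + (J (e i)).size)
      then some (e i) else none, ?_, ?_, ?_, ?_⟩⟩
  · intro i j
    rw [key]
    split_ifs
    · exact measurableSet_Icc
    · exact MeasurableSet.empty
  · intro i t j h
    have h' : t ∈ {t : ℝ | (if t ∈ Set.Icc (J (e i)).release
        ((J (e i)).release + (J (e i)).size) then some (e i) else none) = some j} := h
    rw [key] at h'
    split_ifs at h' with hij
    · exact ⟨h'.1, h'.2.trans (J j).release_add_size_le⟩
    · exact h'.elim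
  · intro i i' t j h h'
    simp only [Option.ite_none_right_eq_some, Option.some.injEq] at h h'
    exact e.injective (h.2.trans h'.2.symm)
  · intro j
    simp only [key]
    rw [Finset.sum_eq_single (e.symm j)]
    · simp [(J j).size_pos.le]
    · intro i _ hi
      have : e i ≠ j := fun h => hi (by rw [← h]; simp)
      simp [this]
    · simp

/-- The minimum number `m*` of machines on which the jobs `J` can be feasibly scheduled. -/
def minMachines {ι : Type} (J : ι → Job) : ℕ := sInf {m | FeasibleOn J m}

theorem feasibleOn_minMachines {ι : Type} [Fintype ι] (J : ι → Job) :
    FeasibleOn J (minMachines J) :=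
  Nat.sInf_mem (s := {m | FeasibleOn J m}) ⟨_, feasibleOn_card J⟩

/-- `T` is a finite union of intervals (of any kind). -/
def IsFiniteUnionOfIntervals (T : Set ℝ) : Prop :=
  ∃ F : Set (Set ℝ), F.Finite ∧ (∀ I ∈ F, I.OrdConnected) ∧ T = ⋃₀ F

/-- The set `G` of `α`-tight jobs and the set `T` of times form a weakly `(μ, β)`-critical pair. -/
structure IsWeaklyCritical {ι : Type} (J : ι → Job) (α : ℝ) (μ : ℕ) (β : ℝ)
    (G : Finset ι) (T : Set ℝ) : Prop where
  tight : ∀ j ∈ G, (J j).IsTight α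
  nonempty : T.Nonempty
  intervals : IsFiniteUnionOfIntervals T
  /-- Each time of `T` lies in the lifespans of at least `μ` distinct jobs of `G`. -/
  covered : ∀ t ∈ T, ∃ S ⊆ G, μ ≤ S.card ∧ ∀ j ∈ S, t ∈ (J j).lifespan
  measure_ge : β / μ * ∑ j ∈ G, (J j).laxity ≤ volume.real T

end

/-! Write τ_j for the measure of T ∩ I(j). Inside any set U of times a schedule must spend at least
|U ∩ I(j)| - ℓ_j on job j, and m machines provide at most m|U|. Taking U = T handles only jobs with
ℓ_j ≤ τ_j/2.

For jobs with xτ_j ≤ ℓ_j ≤ qxτ_j, T is inflated to a set U of measure O(qx|T|) that meets each I(j)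
in measure at least min(|I(j)|, 2qxτ_j). Either at least qxτ_j units are forced into U, or U
contains almost all of I(j) and the whole size counts; the size is at least a multiple κqx of τ_j by
tightness. Hence κ∑τ_j = O(m|T|) per class (`Schedule.mul_sum_measureReal_inter_lifespan_le`). The
set U comes from a Vitali covering and a rising sun argument.

By criticality, jobs with ℓ_j > 2τ_j/β carry at most half of the cover μ|T|. The others fall into n
+ 1 classes with q^n ≥ 4/β, so κμ = O(mn). For α ≥ 1/2 take q = 1/(1-α) and κ = 1/2; for α < 1/2
take q = 2 and κ = α/2, where the factor α is regained from log(1/(1-α)) ≤ 2α. -/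

/-! ### Inflating a set of times: dense hull and rising sun -/

/-- The union of the intervals in which the set `T` has density at least `lam`. -/
def denseHull (T : Set ℝ) (lam : ℝ) : Set ℝ :=
  {x | ∃ a b, a < b ∧ x ∈ Set.Icc a b ∧ lam * (b - a) ≤ volume.real (T ∩ Set.Icc a b)}

/-- Vitali: disjoint dense intervals, enlarged by the factor 4, cover the hull, and each has length
at most 1/`lam` times its share of T. -/
theorem volume_denseHull_le {T : Set ℝ} (hT : MeasurableSet T) (hfin : volume T ≠ ⊤)
    {lam : ℝ} (hlam : 0 < lam) :
    volume (denseHull T lam) ≤ ENNReal.ofReal (4 / lam * volume.real T) := by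
  set S : Set (ℝ × ℝ) := {p | p.1 < p.2 ∧
    lam * (p.2 - p.1) ≤ volume.real (T ∩ Set.Icc p.1 p.2)} with hS
  have hball : ∀ p : ℝ × ℝ, Metric.closedBall ((p.1 + p.2) / 2) ((p.2 - p.1) / 2) =
      Set.Icc p.1 p.2 := by
    intro p
    rw [Real.closedBall_eq_Icc]
    congr 1 <;> ring
  obtain ⟨u, huS, hdisj, hcov⟩ :=
    Vitali.exists_disjoint_subfamily_covering_enlargement_closedBall S
      (fun p => (p.1 + p.2) / 2) (fun p => (p.2 - p.1) / 2) (volume.real T / lam) (by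
        rintro p ⟨hp, hp'⟩
        have h1 : volume.real (T ∩ Set.Icc p.1 p.2) ≤ volume.real T :=
          measureReal_mono Set.inter_subset_left hfin
        rw [le_div_iff₀ hlam]
        nlinarith [mul_pos hlam (sub_pos.2 hp)]) 4 (by norm_num)
  simp only [hball] at hdisj hcov
  have hcount : u.Countable := by
    refine hdisj.countable_of_nonempty_interior fun p hp => ?_
    rw [interior_Icc]
    exact Set.nonempty_Ioo.2 (huS hp).1
  have hsub : denseHull T lam ⊆
      ⋃ p ∈ u, Metric.closedBall ((p.1 + p.2) / 2) (4 * ((p.2 - p.1) / 2)) := by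
    rintro x ⟨a, b, hab, hx, hd⟩
    obtain ⟨p, hp, hsub⟩ := hcov (a, b) ⟨hab, hd⟩
    exact Set.mem_biUnion hp (hsub hx)
  calc volume (denseHull T lam)
      ≤ volume (⋃ p ∈ u, Metric.closedBall ((p.1 + p.2) / 2) (4 * ((p.2 - p.1) / 2))) :=
        measure_mono hsub
    _ ≤ ∑' p : u, volume (Metric.closedBall ((p.1.1 + p.1.2) / 2) (4 * ((p.1.2 - p.1.1) / 2))) :=
        measure_biUnion_le _ hcount _
    _ ≤ ∑' p : u, ENNReal.ofReal (4 / lam) * volume (T ∩ Set.Icc p.1.1 p.1.2) := by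
        refine ENNReal.tsum_le_tsum fun p => ?_
        have hp := (huS p.2).2
        have hf : volume (T ∩ Set.Icc p.1.1 p.1.2) ≠ ⊤ :=
          ne_top_of_le_ne_top hfin (measure_mono Set.inter_subset_left)
        rw [Real.volume_closedBall, ← ENNReal.ofReal_toReal hf,
          ← ENNReal.ofReal_mul (by positivity)]
        refine ENNReal.ofReal_le_ofReal ?_
        change _ ≤ 4 / lam * volume.real (T ∩ Set.Icc p.1.1 p.1.2)
        rw [div_mul_eq_mul_div, le_div_iff₀ hlam]
        linarith
    _ = ENNReal.ofReal (4 / lam) * volume (⋃ p ∈ u, T ∩ Set.Icc p.1 p.2) := by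
        rw [ENNReal.tsum_mul_left, measure_biUnion hcount]
        · exact hdisj.mono fun p => Set.inter_subset_right
        · exact fun p _ => hT.inter measurableSet_Icc
    _ ≤ ENNReal.ofReal (4 / lam) * volume T := by
        gcongr
        exact Set.iUnion₂_subset fun p _ => Set.inter_subset_left
    _ = ENNReal.ofReal (4 / lam * volume.real T) := by
        rw [ENNReal.ofReal_mul (by positivity), Measure.real, ENNReal.ofReal_toReal hfin]

theorem integral_indicator_sub_const {T : Set ℝ} (hT : MeasurableSet T) (lam : ℝ) {a b : ℝ}
    (hab : a ≤ b) :
    ∫ t in a..b, (T.indicator 1 t - lam) = volume.real (T ∩ Set.Icc a b) - lam * (b - a) := by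
  have hi : IntervalIntegrable (T.indicator (1 : ℝ → ℝ)) volume a b := by
    rw [intervalIntegrable_iff]
    exact (integrableOn_const (by simp)).indicator hT
  rw [intervalIntegral.integral_sub hi intervalIntegrable_const,
    intervalIntegral.integral_of_le hab, ← integral_Icc_eq_integral_Ioc,
    integral_indicator_one hT, intervalIntegral.integral_const, measureReal_restrict_apply hT]
  simp [mul_comm]

/-- A form of the rising sun lemma: an interval meets every set containing the dense hull of `T` in
at least the measure that is needed to dilute its part of `T` to density `lam`. -/
theorem min_le_measureReal_inter_of_denseHull_subset {T U : Set ℝ} (hT : MeasurableSet T)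
    (hU : MeasurableSet U) {lam : ℝ} (hlam : 0 < lam) (hlam1 : lam < 1)
    (hsub : denseHull T lam ⊆ U) {a b : ℝ} (hab : a ≤ b) :
    min (b - a) (volume.real (T ∩ Set.Icc a b) / lam) ≤ volume.real (U ∩ Set.Icc a b) := by
  rcases hab.eq_or_lt with rfl | hlt
  · exact (min_le_left _ _).trans (by simp)
  rcases le_or_gt (lam * (b - a)) (volume.real (T ∩ Set.Icc a b)) with hd | hd
  · have : Set.Icc a b ⊆ U := fun x hx => hsub ⟨a, b, hlt, hx, hd⟩
    rw [Set.inter_eq_right.2 this]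
    simp [hab]
  set f : ℝ → ℝ := fun t => T.indicator 1 t - lam with hf
  have hfl : LocallyIntegrable f volume :=
    ((locallyIntegrable_const (1 : ℝ)).indicator hT).sub (locallyIntegrable_const lam)
  have hfi : ∀ x y, IntervalIntegrable f volume x y := fun x y =>
    intervalIntegrable_iff.mpr
      ((hfl.integrableOn_isCompact isCompact_uIcc).mono_set Set.uIoc_subset_uIcc)
  set F : ℝ → ℝ := fun x => ∫ t in a..x, f t with hF
  have hFsub : ∀ x y, x ≤ y → F y - F x = volume.real (T ∩ Set.Icc x y) - lam * (y - x) := by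
    intro x y hxy
    rw [← integral_indicator_sub_const hT lam hxy]
    exact intervalIntegral.integral_interval_sub_left (hfi _ _) (hfi _ _)
  -- A point off U lies in no dense interval, so F drops strictly across every interval containing
  -- it. This gives both the sign of F' and injectivity.
  have hanti : ∀ x y z, x < y → z ∈ Set.Icc x y → z ∉ U → F y < F x := by
    intro x y z hxy hz hzU
    by_contra! h
    exact hzU (hsub ⟨x, y, hxy, hz, by linarith [hFsub x y hxy.le]⟩)
  have hae : ∀ᵐ x, HasDerivAt F (f x) x :=
    (LocallyIntegrable.ae_hasDerivAt_integral hfl).mono fun x hx => hx a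
  obtain ⟨N, hsubN, hNm, hN⟩ := exists_measurable_superset_of_null (ae_iff.1 hae)
  set S : Set ℝ := (Set.Ioo a b \ U) \ N with hS
  have hSm : MeasurableSet S := (measurableSet_Ioo.diff hU).diff hNm
  have hSder : ∀ x ∈ S, HasDerivAt F (f x) x := fun x hx => by
    by_contra h
    exact hx.2 (hsubN h)
  -- At a point of T the slope would be 1 - `lam` > 0, but F decreases to the right of points off U.
  have hSf : ∀ x ∈ S, f x = -lam := by
    intro x hx
    by_contra hne
    have hxT : x ∈ T := by
      by_contra hxT
      exact hne (by simp [hf, hxT])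
    have hle : f x ≤ 0 := by
      have ht := hasDerivWithinAt_iff_tendsto_slope.1 ((hSder x hx).hasDerivWithinAt (s := Set.Ioi x))
      rw [Set.sdiff_singleton_eq_self (by simp)] at ht
      refine le_of_tendsto ht ?_
      filter_upwards [self_mem_nhdsWithin] with y hy
      rw [slope_def_field]
      have := hanti x y x hy (Set.left_mem_Icc.2 (le_of_lt hy)) hx.1.2
      exact div_nonpos_of_nonpos_of_nonneg (by linarith) (sub_nonneg.2 (le_of_lt hy))
    have : f x = 1 - lam := by simp [hf, hxT]
    linarith
  have hinj : Set.InjOn F S := by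
    intro x hx y hy hxy
    rcases lt_trichotomy x y with h | h | h
    · have := hanti x y x h (Set.left_mem_Icc.2 h.le) hx.1.2
      linarith
    · exact h
    · have := hanti y x y h (Set.left_mem_Icc.2 h.le) hy.1.2
      linarith
  have himg : F '' S ⊆ Set.Icc (F b) (F a) := by
    rintro _ ⟨x, hx, rfl⟩
    have hxab := hx.1.1
    exact ⟨(hanti x b x hxab.2 (Set.left_mem_Icc.2 hxab.2.le) hx.1.2).le,
      (hanti a x x hxab.1 (Set.right_mem_Icc.2 hxab.1.le) hx.1.2).le⟩
  -- Change of variables: |F'| = `lam` on S and F(S) lies in [F b, F a], so `lam`·|S| ≤ F a - F b.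
  have harea := lintegral_image_eq_lintegral_abs_deriv_mul hSm
    (fun x hx => (hSder x hx).hasDerivWithinAt) hinj 1
  simp only [Pi.one_apply, mul_one, lintegral_one, Measure.restrict_apply_univ] at harea
  rw [setLIntegral_congr_fun hSm (g := fun _ => ENNReal.ofReal lam)
    (fun x hx => by simp [hSf x hx, abs_of_pos hlam]), setLIntegral_const] at harea
  have hSv : volume S = volume (Set.Icc a b \ U) := by
    rw [hS, measure_sdiff_null hN]
    exact measure_congr (Ioo_ae_eq_Icc.diff (ae_eq_refl U))
  have hSle : lam * volume.real (Set.Icc a b \ U) ≤ F a - F b := by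
    have h1 : ENNReal.ofReal lam * volume S ≤ ENNReal.ofReal (F a - F b) := by
      rw [← harea, ← Real.volume_Icc]
      exact measure_mono himg
    have h2 := ENNReal.toReal_mono ENNReal.ofReal_ne_top h1
    rw [ENNReal.toReal_mul, ENNReal.toReal_ofReal hlam.le, ENNReal.toReal_ofReal, hSv] at h2
    · exact h2
    · linarith [hFsub a b hab]
  have hsplit := measureReal_inter_add_sdiff (μ := volume) (s := Set.Icc a b) hU
    (by simp [Real.volume_Icc])
  rw [Real.volume_real_Icc_of_le hab, Set.inter_comm] at hsplit
  refine (min_le_right _ _).trans ?_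
  rw [div_le_iff₀ hlam]
  nlinarith [hFsub a b hab]

/-- The set `T` is contained, up to a null set, in a set of measure `O(|T| / lam)` that meets every
interval in at least the measure needed to dilute its part of `T` to density `lam`. -/
theorem exists_measurableSet_min_le_measureReal_inter {T : Set ℝ} (hT : MeasurableSet T)
    (hfin : volume T ≠ ⊤) {lam : ℝ} (hlam : 0 < lam) (hlam1 : lam < 1) :
    ∃ U : Set ℝ, MeasurableSet U ∧ volume U ≠ ⊤ ∧ volume.real U ≤ 4 / lam * volume.real T ∧
      ∀ a b, a ≤ b →
        min (b - a) (volume.real (T ∩ Set.Icc a b) / lam) ≤ volume.real (U ∩ Set.Icc a b) := by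
  have hle := volume_denseHull_le hT hfin hlam
  rw [← measure_toMeasurable] at hle
  exact ⟨toMeasurable volume (denseHull T lam), measurableSet_toMeasurable _ _,
    ne_top_of_le_ne_top ENNReal.ofReal_ne_top hle,
    ENNReal.toReal_le_of_le_ofReal (by positivity) hle, fun a b hab =>
      min_le_measureReal_inter_of_denseHull_subset hT (measurableSet_toMeasurable _ _) hlam hlam1
        (subset_toMeasurable _ _) hab⟩

/-! ### Work forced into a set of times -/

theorem Job.laxity_nonneg (j : Job) : 0 ≤ j.laxity := by
  have := j.release_add_size_le
  unfold Job.laxity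
  linarith

theorem Job.release_lt_deadline (j : Job) : j.release < j.deadline := by
  have := j.release_add_size_le
  have := j.size_pos
  linarith

theorem Job.measurableSet_lifespan (j : Job) : MeasurableSet j.lifespan := measurableSet_Icc

theorem Job.volume_lifespan_ne_top (j : Job) : volume j.lifespan ≠ ⊤ := by
  simp [Job.lifespan, Real.volume_Icc]

theorem Job.measureReal_lifespan (j : Job) : volume.real j.lifespan = j.deadline - j.release :=
  Real.volume_real_Icc_of_le j.release_lt_deadline.le

/-- Within a set `U` of times, a schedule devotes to a job at least the measure of the part of its
lifespan in `U`, up to the laxity. -/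
theorem Schedule.measureReal_inter_lifespan_sub_laxity_le {ι : Type} {J : ι → Job} {m : ℕ}
    (s : Schedule J m) {U : Set ℝ} (hU : MeasurableSet U) (j : ι) :
    volume.real (U ∩ (J j).lifespan) - (J j).laxity ≤
      ∑ i, volume.real (U ∩ {t | s.run i t = some j}) := by
  have hsub : ∀ i, {t | s.run i t = some j} ⊆ (J j).lifespan := fun i t ht =>
    s.mem_lifespan i t j ht
  have hfin : ∀ i, volume {t | s.run i t = some j} ≠ ⊤ := fun i =>
    ne_top_of_le_ne_top (J j).volume_lifespan_ne_top (measure_mono (hsub i))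
  have h1 : ∑ i, volume.real (U ∩ {t | s.run i t = some j}) +
      ∑ i, volume.real ({t | s.run i t = some j} \ U) = (J j).size := by
    rw [← s.completes j, ← Finset.sum_add_distrib]
    refine Finset.sum_congr rfl fun i _ => ?_
    rw [Set.inter_comm]
    exact measureReal_inter_add_sdiff hU (hfin i)
  have h2 : ∑ i, volume.real ({t | s.run i t = some j} \ U) ≤
      volume.real ((J j).lifespan \ U) := by
    rw [← measureReal_biUnion_finset (h := fun i _ =>
      ne_top_of_le_ne_top (hfin i) (measure_mono Set.sdiff_subset))]
    · refine measureReal_mono ?_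
        (ne_top_of_le_ne_top (J j).volume_lifespan_ne_top (measure_mono Set.sdiff_subset))
      exact Set.iUnion₂_subset fun i _ => Set.sdiff_subset_sdiff_left (hsub i)
    · intro i _ i' _ hne
      refine Set.disjoint_left.2 fun t ht ht' => hne ?_
      exact s.not_parallel i i' t j ht.1 ht'.1
    · exact fun i _ => (s.measurableSet_run i j).diff hU
  have h3 := measureReal_inter_add_sdiff (μ := volume) (s := (J j).lifespan) hU
    (J j).volume_lifespan_ne_top
  rw [(J j).measureReal_lifespan, Set.inter_comm] at h3
  unfold Job.laxity
  linarith

theorem Schedule.sum_measureReal_inter_le {ι : Type} {J : ι → Job} {m : ℕ}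
    (s : Schedule J m) {U : Set ℝ} (hU : MeasurableSet U) (hfin : volume U ≠ ⊤) (G : Finset ι) :
    ∑ j ∈ G, ∑ i, volume.real (U ∩ {t | s.run i t = some j}) ≤ m * volume.real U := by
  rw [Finset.sum_comm]
  calc ∑ i, ∑ j ∈ G, volume.real (U ∩ {t | s.run i t = some j})
      ≤ ∑ _i : Fin m, volume.real U := by
        refine Finset.sum_le_sum fun i _ => ?_
        rw [← measureReal_biUnion_finset (h := fun j _ =>
          ne_top_of_le_ne_top hfin (measure_mono Set.inter_subset_left))]
        · exact measureReal_mono (Set.iUnion₂_subset fun j _ => Set.inter_subset_left) hfin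
        · intro j _ j' _ hne
          refine Set.disjoint_left.2 fun t ht ht' => hne ?_
          have h1 : s.run i t = some j := ht.2
          have h2 : s.run i t = some j' := ht'.2
          exact Option.some.inj (h1.symm.trans h2)
        · exact fun j _ => hU.inter (s.measurableSet_run i j)
    _ = m * volume.real U := by simp

/-- The volume bound: within `U`, the machines have to do at least the unavoidable work. -/
theorem Schedule.sum_le_of_le_measureReal_inter_lifespan_sub_laxity {ι : Type} {J : ι → Job} {m : ℕ}
    (s : Schedule J m) {U : Set ℝ} (hU : MeasurableSet U) (hfin : volume U ≠ ⊤) (G : Finset ι)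
    {w : ι → ℝ} (hw : ∀ j ∈ G, w j ≤ volume.real (U ∩ (J j).lifespan) - (J j).laxity) :
    ∑ j ∈ G, w j ≤ m * volume.real U :=
  (Finset.sum_le_sum fun j hj => (hw j hj).trans
    (s.measureReal_inter_lifespan_sub_laxity_le hU j)).trans (s.sum_measureReal_inter_le hU hfin G)

/-! ### Classes of comparable relative laxity -/

/-- The number of machines dominates the average cover of `T` by tight jobs whose laxities are
comparable to the measures of the parts of `T` in their lifespans. -/
theorem Schedule.mul_sum_measureReal_inter_lifespan_le {ι : Type} {J : ι → Job} {m : ℕ}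
    (s : Schedule J m) {T : Set ℝ} (hT : MeasurableSet T) (hfin : volume T ≠ ⊤) (G : Finset ι)
    {α q κ x : ℝ} (hα1 : α < 1) (hκ : 0 ≤ κ) (hκ1 : κ ≤ 1) (hκq : κ * (q * (1 - α)) ≤ α)
    (hq : 0 < q) (hx : 0 < x) (hqx : 1 ≤ q * x) (htight : ∀ j ∈ G, (J j).IsTight α)
    (hlow : ∀ j ∈ G, x * volume.real (T ∩ (J j).lifespan) ≤ (J j).laxity)
    (hhigh : ∀ j ∈ G, (J j).laxity ≤ q * x * volume.real (T ∩ (J j).lifespan)) :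
    κ * ∑ j ∈ G, volume.real (T ∩ (J j).lifespan) ≤ 8 * m * volume.real T := by
  -- This density makes U meet a lifespan in 2qxτ, twice the largest laxity allowed; `hqx` keeps it
  -- below 1.
  obtain ⟨U, hU, hUfin, hUle, hUI⟩ := exists_measurableSet_min_le_measureReal_inter hT hfin
    (lam := 1 / (2 * (q * x))) (by positivity) (by rw [div_lt_one (by positivity)]; linarith)
  have key := s.sum_le_of_le_measureReal_inter_lifespan_sub_laxity hU hUfin G
    (w := fun j => q * x * (κ * volume.real (T ∩ (J j).lifespan))) (by
      intro j hj
      have hI := hUI _ _ (J j).release_lt_deadline.le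
      change min _ (volume.real (T ∩ (J j).lifespan) / _) ≤ volume.real (U ∩ (J j).lifespan) at hI
      have hlo := hlow j hj
      have hhi := hhigh j hj
      have hti := htight j hj
      unfold Job.IsTight at hti
      set τ := volume.real (T ∩ (J j).lifespan) with hτ
      have hτ0 : 0 ≤ τ := measureReal_nonneg
      have hqx0 : 0 < q * x := by positivity
      rcases min_le_iff.1 hI with h | h
      -- U fills the lifespan in measure, so the full size is forced; tightness gives (1-α)·size ≥
      -- α·laxity ≥ αxτ.
      · have hsize : q * x * (κ * τ) ≤ (J j).size := by
          have h1 : α * (J j).laxity ≤ (1 - α) * (J j).size := by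
            unfold Job.laxity
            linarith
          have h2 : κ * (q * (1 - α)) * (x * τ) ≤ α * (x * τ) := by gcongr
          have hα0 : 0 ≤ α := le_trans (by
            have : 0 < 1 - α := by linarith
            positivity) hκq
          have h3 : α * (x * τ) ≤ α * (J j).laxity := by gcongr
          have h4 : (1 - α) * (q * x * (κ * τ)) ≤ (1 - α) * (J j).size := by nlinarith
          exact le_of_mul_le_mul_left h4 (by linarith)
        have : (J j).size = (J j).deadline - (J j).release - (J j).laxity := by
          unfold Job.laxity
          ring
        linarith
      · have h1 : τ / (1 / (2 * (q * x))) = 2 * (q * x * τ) := by field_simp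
        have h2 : q * x * (κ * τ) ≤ q * x * (1 * τ) := by gcongr
        linarith)
  rw [← Finset.mul_sum, ← Finset.mul_sum] at key
  have h1 : (4 : ℝ) / (1 / (2 * (q * x))) = 8 * (q * x) := by field_simp; norm_num
  rw [h1] at hUle
  have h2 : (m : ℝ) * volume.real U ≤ m * (8 * (q * x) * volume.real T) := by gcongr
  have hqx0 : 0 < q * x := by positivity
  refine le_of_mul_le_mul_left ?_ hqx0
  linarith

/-- Summing over geometrically growing ranges of laxities. -/
theorem Schedule.mul_sum_filter_laxity_le {ι : Type} {J : ι → Job} {m : ℕ}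
    (s : Schedule J m) {T : Set ℝ} (hT : MeasurableSet T) (hfin : volume T ≠ ⊤) (G : Finset ι)
    {α q κ : ℝ} (hα1 : α < 1) (hκ : 0 ≤ κ) (hκ1 : κ ≤ 1) (hκq : κ * (q * (1 - α)) ≤ α)
    (hq : 2 ≤ q) (htight : ∀ j ∈ G, (J j).IsTight α) (n : ℕ) :
    κ * ∑ j ∈ G with (J j).laxity ≤ q ^ n / 2 * volume.real (T ∩ (J j).lifespan),
      volume.real (T ∩ (J j).lifespan) ≤ 8 * m * (n + 1) * volume.real T := by
  induction n with
  | zero =>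
    -- No inflation is needed here: U = T already forces τ - τ/2.
    have h := s.sum_le_of_le_measureReal_inter_lifespan_sub_laxity hT hfin
      (G.filter fun j => (J j).laxity ≤ q ^ 0 / 2 * volume.real (T ∩ (J j).lifespan))
      (w := fun j => 1 / 2 * volume.real (T ∩ (J j).lifespan)) (by
        intro j hj
        have := (Finset.mem_filter.1 hj).2
        rw [pow_zero] at this
        linarith)
    rw [← Finset.mul_sum] at h
    set A := ∑ j ∈ G with (J j).laxity ≤ q ^ 0 / 2 * volume.real (T ∩ (J j).lifespan),
      volume.real (T ∩ (J j).lifespan)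
    have hA : 0 ≤ A := Finset.sum_nonneg fun j _ => measureReal_nonneg
    have h1 : κ * A ≤ 1 * A := by gcongr
    have h2 : 0 ≤ m * volume.real T := by positivity
    simp only [Nat.cast_zero, zero_add, mul_one]
    linarith
  | succ n ih =>
    classical
    set P : ℕ → ι → Prop := fun n j =>
      (J j).laxity ≤ q ^ n / 2 * volume.real (T ∩ (J j).lifespan) with hP
    have hstep := s.mul_sum_measureReal_inter_lifespan_le hT hfin
      ((G.filter (P (n + 1))).filter fun j => ¬ P n j) (x := q ^ n / 2) hα1 hκ hκ1 hκq
      (by linarith) (by positivity) (by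
        have : (1 : ℝ) ≤ q ^ n := one_le_pow₀ (by linarith)
        nlinarith)
      (fun j hj => htight j (Finset.mem_filter.1 (Finset.mem_filter.1 hj).1).1)
      (fun j hj => (not_le.1 (Finset.mem_filter.1 hj).2).le)
      (fun j hj => by
        have := (Finset.mem_filter.1 (Finset.mem_filter.1 hj).1).2
        simp only [hP] at this
        convert this using 2
        ring)
    have hsplit := Finset.sum_filter_add_sum_filter_not (G.filter (P (n + 1))) (P n)
      fun j => volume.real (T ∩ (J j).lifespan)
    have hle : ∑ j ∈ (G.filter (P (n + 1))).filter (P n), volume.real (T ∩ (J j).lifespan) ≤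
        ∑ j ∈ G.filter (P n), volume.real (T ∩ (J j).lifespan) :=
      Finset.sum_le_sum_of_subset_of_nonneg
        (Finset.filter_subset_filter _ (Finset.filter_subset _ _)) fun _ _ _ => measureReal_nonneg
    have hle' := mul_le_mul_of_nonneg_left hle hκ
    rw [← hsplit, mul_add]
    push_cast
    linarith

/-! ### Cover of T by a critical pair -/

theorem IsFiniteUnionOfIntervals.measurableSet {T : Set ℝ} (h : IsFiniteUnionOfIntervals T) :
    MeasurableSet T := by
  obtain ⟨F, hF, hord, rfl⟩ := h
  exact MeasurableSet.sUnion hF.countable fun I hI => (hord I hI).measurableSet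

theorem IsWeaklyCritical.volume_ne_top {ι : Type} {J : ι → Job} {α β : ℝ} {μ : ℕ} {G : Finset ι}
    {T : Set ℝ} (h : IsWeaklyCritical J α μ β G T) (hμ : 0 < μ) : volume T ≠ ⊤ := by
  have hsub : T ⊆ ⋃ j ∈ G, (J j).lifespan := by
    intro t ht
    obtain ⟨S, hSG, hcard, hS⟩ := h.covered t ht
    obtain ⟨j, hj⟩ := Finset.card_pos.1 (hμ.trans_le hcard)
    exact Set.mem_biUnion (hSG hj) (hS j hj)
  exact ne_top_of_le_ne_top
    (measure_biUnion_lt_top G.finite_toSet fun j _ => (J j).volume_lifespan_ne_top.lt_top).ne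
    (measure_mono hsub)

theorem IsWeaklyCritical.mul_measureReal_le_sum {ι : Type} {J : ι → Job} {α β : ℝ} {μ : ℕ}
    {G : Finset ι} {T : Set ℝ} (h : IsWeaklyCritical J α μ β G T) (hμ : 0 < μ) :
    μ * volume.real T ≤ ∑ j ∈ G, volume.real (T ∩ (J j).lifespan) := by
  have hfin := h.volume_ne_top hμ
  have hT := h.intervals.measurableSet
  have hint : ∀ j ∈ G, IntegrableOn ((J j).lifespan.indicator (1 : ℝ → ℝ)) T := fun j _ =>
    (integrableOn_const (C := (1 : ℝ)) hfin).indicator (J j).measurableSet_lifespan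
  calc μ * volume.real T = ∫ _t in T, (μ : ℝ) := by simp [mul_comm]
    _ ≤ ∫ t in T, ∑ j ∈ G, (J j).lifespan.indicator (1 : ℝ → ℝ) t := by
        refine setIntegral_mono_on (integrableOn_const hfin) (integrable_finsetSum _ hint) hT ?_
        intro t ht
        obtain ⟨S, hSG, hcard, hS⟩ := h.covered t ht
        calc (μ : ℝ) ≤ S.card := by exact_mod_cast hcard
          _ = ∑ j ∈ S, (J j).lifespan.indicator (1 : ℝ → ℝ) t := by
            rw [Finset.sum_congr rfl fun j hj => Set.indicator_of_mem (hS j hj) _]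
            simp
          _ ≤ _ := Finset.sum_le_sum_of_subset_of_nonneg hSG fun j _ _ =>
            Set.indicator_nonneg (fun _ _ => zero_le_one) _
    _ = ∑ j ∈ G, volume.real (T ∩ (J j).lifespan) := by
        rw [integral_finsetSum _ hint]
        refine Finset.sum_congr rfl fun j _ => ?_
        rw [integral_indicator_one (J j).measurableSet_lifespan,
          measureReal_restrict_apply (J j).measurableSet_lifespan, Set.inter_comm]

/-! ### The degenerate case of null T -/

/-- Jobs without laxity that share a nondegenerate interval need one machine each. -/
theorem Schedule.card_le_of_Icc_subset_lifespan {ι : Type} {J : ι → Job} {m : ℕ}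
    (s : Schedule J m) {S : Finset ι} {a b : ℝ} (hab : a < b)
    (hS : ∀ j ∈ S, Set.Icc a b ⊆ (J j).lifespan) (hlax : ∀ j ∈ S, (J j).laxity = 0) :
    S.card ≤ m := by
  have h := s.sum_le_of_le_measureReal_inter_lifespan_sub_laxity (U := Set.Icc a b)
    measurableSet_Icc (by simp [Real.volume_Icc]) S (w := fun _ => b - a) (by
      intro j hj
      rw [Set.inter_eq_left.2 (hS j hj), hlax j hj, Real.volume_real_Icc_of_le hab.le, sub_zero])
  rw [Finset.sum_const, nsmul_eq_mul, Real.volume_real_Icc_of_le hab.le] at h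
  exact_mod_cast le_of_mul_le_mul_right h (sub_pos.2 hab)

/-- Closed lifespans may meet only in t. Those reaching beyond t share an interval to its right, the
others one to its left; hence the factor 2. -/
theorem Schedule.card_le_two_mul_of_mem_lifespan {ι : Type} {J : ι → Job} {m : ℕ}
    (s : Schedule J m) {S : Finset ι} {t : ℝ} (hS : ∀ j ∈ S, t ∈ (J j).lifespan)
    (hlax : ∀ j ∈ S, (J j).laxity = 0) : S.card ≤ 2 * m := by
  have hright : (S.filter fun j => t < (J j).deadline).card ≤ m := by
    have hev : ∀ᶠ y in nhdsWithin t (Set.Ioi t),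
        ∀ j ∈ S.filter fun j => t < (J j).deadline, y < (J j).deadline :=
      (Filter.eventually_all_finset _).2 fun j hj =>
        nhdsWithin_le_nhds (eventually_lt_nhds (Finset.mem_filter.1 hj).2)
    obtain ⟨y, hy, hty⟩ := (hev.and self_mem_nhdsWithin).exists
    exact s.card_le_of_Icc_subset_lifespan hty
      (fun j hj => Set.Icc_subset_Icc (hS j (Finset.mem_filter.1 hj).1).1 (hy j hj).le)
      fun j hj => hlax j (Finset.mem_filter.1 hj).1
  have hleft : (S.filter fun j => ¬ t < (J j).deadline).card ≤ m := by
    have hev : ∀ᶠ y in nhdsWithin t (Set.Iio t),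
        ∀ j ∈ S.filter fun j => ¬ t < (J j).deadline, (J j).release < y :=
      (Filter.eventually_all_finset _).2 fun j hj => nhdsWithin_le_nhds (eventually_gt_nhds
        ((J j).release_lt_deadline.trans_le (not_lt.1 (Finset.mem_filter.1 hj).2)))
    obtain ⟨y, hy, hyt⟩ := (hev.and self_mem_nhdsWithin).exists
    exact s.card_le_of_Icc_subset_lifespan hyt
      (fun j hj => Set.Icc_subset_Icc (hy j hj).le (hS j (Finset.mem_filter.1 hj).1).2)
      fun j hj => hlax j (Finset.mem_filter.1 hj).1
  have := Finset.card_filter_add_card_filter_not (s := S) fun j => t < (J j).deadline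
  omega

theorem IsWeaklyCritical.le_two_mul_of_measureReal_eq_zero {ι : Type} {J : ι → Job} {α β : ℝ}
    {μ : ℕ} {G : Finset ι} {T : Set ℝ} (h : IsWeaklyCritical J α μ β G T) (hμ : 0 < μ)
    (hβ : 0 < β) (hT : volume.real T = 0) {m : ℕ} (s : Schedule J m) : μ ≤ 2 * m := by
  obtain ⟨t, ht⟩ := h.nonempty
  obtain ⟨S, hSG, hcard, hS⟩ := h.covered t ht
  have hle := h.measure_ge
  rw [hT] at hle
  have hμ' : (0 : ℝ) < μ := by exact_mod_cast hμ
  have hsum : ∑ j ∈ G, (J j).laxity ≤ 0 := by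
    by_contra! hpos
    have : 0 < β / μ * ∑ j ∈ G, (J j).laxity := by positivity
    linarith
  have hzero := (Finset.sum_eq_zero_iff_of_nonneg fun j _ => (J j).laxity_nonneg).1
    (hsum.antisymm (Finset.sum_nonneg fun j _ => (J j).laxity_nonneg))
  exact hcard.trans (s.card_le_two_mul_of_mem_lifespan hS fun j hj => hzero j (hSG hj))

/-! ### Choice of parameters and conclusion -/

theorem IsWeaklyCritical.mul_le_of_measureReal_pos {ι : Type} {J : ι → Job} {α β : ℝ}
    {μ : ℕ} {G : Finset ι} {T : Set ℝ} (h : IsWeaklyCritical J α μ β G T) (hμ : 0 < μ)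
    (hβ : 0 < β) (hpos : 0 < volume.real T) {m : ℕ} (s : Schedule J m)
    {q κ : ℝ} (hα1 : α < 1) (hκ : 0 ≤ κ) (hκ1 : κ ≤ 1) (hκq : κ * (q * (1 - α)) ≤ α)
    (hq : 2 ≤ q) {n : ℕ} (hn : 4 / β ≤ q ^ n) : κ * μ ≤ 16 * m * (n + 1) := by
  have hμ' : (0 : ℝ) < μ := by exact_mod_cast hμ
  have hmain := s.mul_sum_filter_laxity_le h.intervals.measurableSet (h.volume_ne_top hμ) G
    hα1 hκ hκ1 hκq hq h.tight n
  have hcov := h.mul_measureReal_le_sum hμ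
  rw [← Finset.sum_filter_add_sum_filter_not G fun j =>
    (J j).laxity ≤ q ^ n / 2 * volume.real (T ∩ (J j).lifespan)] at hcov
  -- Since q^n/2 ≥ 2/β, each of these jobs has τ ≤ βℓ/2, and criticality bounds ∑ℓ.
  have hrest : ∑ j ∈ G with ¬ (J j).laxity ≤ q ^ n / 2 * volume.real (T ∩ (J j).lifespan),
      volume.real (T ∩ (J j).lifespan) ≤ μ / 2 * volume.real T := by
    calc ∑ j ∈ G with ¬ (J j).laxity ≤ q ^ n / 2 * volume.real (T ∩ (J j).lifespan),
          volume.real (T ∩ (J j).lifespan)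
        ≤ ∑ j ∈ G with ¬ (J j).laxity ≤ q ^ n / 2 * volume.real (T ∩ (J j).lifespan),
          β / 2 * (J j).laxity := by
          refine Finset.sum_le_sum fun j hj => ?_
          have h1 := not_le.1 (Finset.mem_filter.1 hj).2
          have h2 : 4 / β / 2 * volume.real (T ∩ (J j).lifespan) ≤
            q ^ n / 2 * volume.real (T ∩ (J j).lifespan) := by gcongr
          have h3 := mul_le_mul_of_nonneg_left (h2.trans h1.le) (half_pos hβ).le
          convert h3 using 1
          field_simp
          ring
      _ ≤ ∑ j ∈ G, β / 2 * (J j).laxity :=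
          Finset.sum_le_sum_of_subset_of_nonneg (Finset.filter_subset _ _) fun j _ _ =>
            mul_nonneg (half_pos hβ).le (J j).laxity_nonneg
      _ = μ / 2 * (β / μ * ∑ j ∈ G, (J j).laxity) := by
          rw [← Finset.mul_sum]
          field_simp
      _ ≤ μ / 2 * volume.real T := by
          gcongr
          exact h.measure_ge
  have hfilter : μ / 2 * volume.real T ≤
      ∑ j ∈ G with (J j).laxity ≤ q ^ n / 2 * volume.real (T ∩ (J j).lifespan),
        volume.real (T ∩ (J j).lifespan) := by linarith
  have := (mul_le_mul_of_nonneg_left hfilter hκ).trans hmain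
  refine le_of_mul_le_mul_right ?_ hpos
  linarith

theorem exists_pow_ge_of_logb {q β : ℝ} (hq : 2 ≤ q) (hβ : 0 < β) (hβ1 : β ≤ 1) :
    ∃ n : ℕ, 4 / β ≤ q ^ n ∧ (n : ℝ) + 1 ≤ Real.logb q (1 / β) + 4 := by
  have hq1 : 1 < q := by linarith
  refine ⟨⌈Real.logb q (4 / β)⌉₊, ?_, ?_⟩
  · rw [← Real.rpow_natCast, ← Real.logb_le_iff_le_rpow hq1 (by positivity)]
    exact Nat.le_ceil _
  · have h4 : Real.logb q 4 ≤ 2 := by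
      rw [Real.logb_le_iff_le_rpow hq1 (by norm_num)]
      norm_num
      nlinarith
    have h40 : 0 ≤ Real.logb q 4 := Real.logb_nonneg hq1 (by norm_num)
    have h1 : 0 ≤ Real.logb q (1 / β) := Real.logb_nonneg hq1 (by rw [le_div_iff₀ hβ]; linarith)
    have hsplit : Real.logb q (4 / β) = Real.logb q 4 + Real.logb q (1 / β) := by
      rw [← Real.logb_mul (by norm_num) (by positivity)]
      ring_nf
    have := Nat.ceil_lt_add_one (a := Real.logb q (4 / β)) (hsplit ▸ add_nonneg h40 h1)
    linarith

theorem IsWeaklyCritical.le_mul_logb {ι : Type} {J : ι → Job} {α β ε : ℝ}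
    {μ : ℕ} {G : Finset ι} {T : Set ℝ} (h : IsWeaklyCritical J α μ β G T) (hμ : 0 < μ)
    (hε : 0 < ε) (hα : 0 < α) (hα1 : α < 1) (hβ : 0 < β) (hβε : β ≤ 1 - ε)
    (hL : ε ≤ Real.logb (1 / (1 - α)) (1 / β)) {m : ℕ} (s : Schedule J m) :
    (μ : ℝ) ≤ 64 * (2 + 4 / ε) * (m * Real.logb (1 / (1 - α)) (1 / β)) := by
  set L := Real.logb (1 / (1 - α)) (1 / β) with hLdef
  have h1α : 0 < 1 - α := by linarith
  have hmL : 0 ≤ m * L := mul_nonneg m.cast_nonneg (hε.le.trans hL)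
  have h4 : 4 ≤ 4 / ε * L := by
    rw [div_mul_eq_mul_div, le_div_iff₀ hε]
    linarith
  rcases (measureReal_nonneg : 0 ≤ volume.real T).eq_or_lt with h0 | hpos
  · have hle : (μ : ℝ) ≤ 2 * m := by
      exact_mod_cast h.le_two_mul_of_measureReal_eq_zero hμ hβ h0.symm s
    have : (m : ℝ) * 4 ≤ m * (4 / ε * L) := by gcongr
    nlinarith
  rcases le_or_gt (1 / 2) α with hα2 | hα2
  · have hq : 2 ≤ 1 / (1 - α) := by
      rw [le_div_iff₀ h1α]
      linarith
    obtain ⟨n, hn, hnL⟩ := exists_pow_ge_of_logb hq hβ (by linarith)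
    have key := h.mul_le_of_measureReal_pos hμ hβ hpos s (κ := 1 / 2) hα1 (by norm_num)
      (by norm_num) (by rw [one_div_mul_cancel h1α.ne']; linarith) hq hn
    have h2 : (n : ℝ) + 1 ≤ (1 + 4 / ε) * L := by linarith
    have h3 : 16 * (m : ℝ) * (n + 1) ≤ 16 * m * ((1 + 4 / ε) * L) := by gcongr
    have h5 : 0 ≤ 4 / ε * (m * L) := by positivity
    linarith
  · obtain ⟨n, hn, hnL⟩ := exists_pow_ge_of_logb (le_refl 2) hβ (by linarith)
    have key := h.mul_le_of_measureReal_pos hμ hβ hpos s (κ := α / 2) hα1 (by linarith)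
      (by linarith) (by nlinarith) (le_refl 2) hn
    -- Keeping β away from 1 lets the additive 4 in the class count be absorbed into log(1/β).
    have hβlog : ε ≤ Real.log (1 / β) := by
      rw [one_div, Real.log_inv]
      linarith [Real.log_le_sub_one_of_pos hβ]
    have hlog0 : 0 < Real.log (1 / (1 - α)) := Real.log_pos (by rw [lt_div_iff₀ h1α]; linarith)
    have hαlog : Real.log (1 / (1 - α)) ≤ 2 * α := by
      refine (Real.log_le_sub_one_of_pos (by positivity)).trans ?_
      rw [sub_le_iff_le_add, div_le_iff₀ h1α]
      nlinarith
    have hL0 : 0 ≤ L := by linarith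
    have hlogL : Real.log (1 / β) ≤ 2 * α * L := by
      have h5 : Real.log (1 / β) = Real.log (1 / (1 - α)) * L := by
        rw [hLdef, Real.logb]
        field_simp
      rw [h5]
      gcongr
    have h2 : Real.logb 2 (1 / β) ≤ 2 * Real.log (1 / β) := by
      rw [Real.logb, div_le_iff₀ (Real.log_pos (by norm_num))]
      nlinarith [Real.log_two_gt_d9]
    have h5 : 4 ≤ 4 / ε * Real.log (1 / β) := by
      rw [div_mul_eq_mul_div, le_div_iff₀ hε]
      linarith
    have h6 : (n : ℝ) + 1 ≤ (2 + 4 / ε) * (2 * α * L) := by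
      have : (2 + 4 / ε) * Real.log (1 / β) ≤ (2 + 4 / ε) * (2 * α * L) := by gcongr
      linarith
    have h7 : 16 * (m : ℝ) * (n + 1) ≤ 16 * m * ((2 + 4 / ε) * (2 * α * L)) := by gcongr
    refine le_of_mul_le_mul_left ?_ (half_pos hα)
    linarith

theorem mainTheorem4 :
    ∀ ε : ℝ, 0 < ε → ∃ c : ℝ, 0 < c ∧
      ∀ (ι : Type) [Fintype ι] (J : ι → Job) (α β : ℝ) (μ : ℕ) (G : Finset ι) (T : Set ℝ),
        0 < α → α < 1 → 0 < β → β ≤ 1 - ε → 0 < μ →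
        ε ≤ Real.logb (1 / (1 - α)) (1 / β) →
        IsWeaklyCritical J α μ β G T →
        c * ((μ : ℝ) / Real.logb (1 / (1 - α)) (1 / β)) ≤ (minMachines J : ℝ) := by
  intro ε hε
  refine ⟨1 / (64 * (2 + 4 / ε)), by positivity, ?_⟩
  intro ι _ J α β μ G T hα hα1 hβ hβε hμ hL h
  obtain ⟨s⟩ := feasibleOn_minMachines J
  have key := h.le_mul_logb hμ hε hα hα1 hβ hβε hL s
  have hL0 := hε.trans_le hL
  rw [div_mul_div_comm, one_mul, div_le_iff₀ (by positivity)]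
  linarith
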